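/- **Theorem (noncommutative BCL-type isometric lift).** Let $d\ge 2$ and let $\underline T=(T_1,\dots,T_d)$ be a $d$-tuple of commuting contractions on a complex Hilbert space $\mathcal H$. Put $T=T_1\cdots T_d$ and $T_{(j)}=T_1\cdots T_{j-1}T_{j+1}\cdots T_d$. *Notation.* For a contraction $S$ let $D_S=(I-S^*S)^{1/2}$ and $\mathcal D_S=\overline{\operatorname{Ran}}\,D_S$. For a Hilbert space $\mathcal F$, $H^2(\mathcal F)$ is the Hilbert space of power series $\sum_{n\ge0}z^nf_n$ with $f_n\in\mathcal F$ and $\sum\|f_n\|^2<\infty$, and $M_{A+zB}$ is multiplication by $A+zB$ on it, where $A,B\in\mathcal B(\mathcal F)$. A *lift* of a tuple $(A_i)$ of operators on $\mathcal H$ consists of an isometry $\Pi:\mathcal H\to\mathcal K$ and operators $S_i$ on $\mathcal K$ with $S_i^*\Pi=\Pi A_i^*$ for all $i$; it is an *isometric lift* if all $S_i$ are isometries (not assumed to commute). *Canonical commutative unitary tuple.* Let $Q\ge 0$ be given by $Q^2=\operatorname{SOT-}\lim_n T^nT^{*n}$, and let $X^*$ and $X_j^*$ be the operators on $\overline{\operatorname{Ran}}\,Q$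 determined by $X^*Q=QT^*$ and $X_j^*Q=QT_j^*$; they are isometries. Let $W_D^*$ on $\mathcal R_D\supseteq\overline{\operatorname{Ran}}\,Q$ be the minimal unitary extension of $X^*$, and let $W_{\partial1},\dots,W_{\partial d}$ be commuting unitaries on $\mathcal R_D$ with $W_{\partial j}^*|_{\overline{\operatorname{Ran}}\,Q}=X_j^*$ and $W_D=W_{\partial1}\cdots W_{\partial d}$. Put $W_{(\partial j)}=\prod_{i\ne j}W_{\partial i}$. *Andô tuple for $\underline T^*=(T_1^*,\dots,T_d^*)$.* Let $\mathcal F_*=\mathcal D_{T_1^*}\oplus\cdots\oplus\mathcal D_{T_d^*}\oplus\mathcal E$ for some Hilbert space $\mathcal E$, and let $P_{j*}$ be the orthogonal projection of $\mathcal F_*$ onto $\mathcal D_{T_j^*}$, with $P_{j*}^\perp=I-P_{j*}$. For $h\in\mathcal H$ let $\Delta_{j}h\in\bigoplus_{i\ne j}\mathcal D_{T_i^*}$ be the vector with component $D_{T_i^*}\big(\prod_{k>i,\,k\ne j}T_k^*\big)h$ in $\mathcal D_{T_i^*}$. Let $\Lambda_{j*}:\mathcal D_{T^*}\to\mathcal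 F_*$ be the isometry determined by $\Lambda_{j*}D_{T^*}h=D_{T_j^*}T_{(j)}^*h\oplus\Delta_jh$, the first term lying in the summand $\mathcal D_{T_j^*}$. Let $U_{j*}$ be unitary operators on $\mathcal F_*$ such that $U_{j*}^*$ extends the isometry $D_{T_j^*}T_{(j)}^*h\oplus\Delta_jh\mapsto D_{T_j^*}h\oplus\Delta_jT_j^*h$ $(h\in\mathcal H)$. Define $\Pi_{j*}:\mathcal H\to H^2(\mathcal F_*)\oplus\mathcal R_D$ by $\Pi_{j*}h=\Big(\sum_{n\ge0}z^n\Lambda_{j*}D_{T^*}T^{*n}h\Big)\oplus Qh$. Then: 1. For each $1\le j\le d$, $$\Pi_{j*}T_j^*=\big(M^*_{U_{j*}P_{j*}^\perp+zU_{j*}P_{j*}}\oplus W_{\partial j}^*\big)\Pi_{j*},\qquad \Pi_{j*}T_{(j)}^*=\big(M^*_{P_{j*}U_{j*}^*+zP_{j*}^\perp U_{j*}^*}\oplus W_{(\partial j)}^*\big)\Pi_{j*},$$ and $\big(\Pi_{j*};\ M_{U_{j*}P_{j*}^\perp+zU_{j*}P_{j*}}\oplus W_{\partial j},\ M_{P_{j*}U_{j*}^*+zP_{j*}^\perp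 U_{j*}^*}\oplus W_{(\partial j)},\ M_z\oplus W_D\big)$ is an isometric lift of $(T_j,T_{(j)},T)$; in particular $\Pi_{j*}$ is an isometry. 2. Let $\tau_{1*},\dots,\tau_{d*}$ be unitary operators on $\mathcal F_*$ with $\tau_{j*}\Lambda_{j*}=\Lambda_{1*}$ for all $j$ and $\tau_{1*}=I$. Then for each $1\le j\le d$, $$\Pi_{1*}T_j^*=\big(M^*_{\tau_{j*}(U_{j*}P_{j*}^\perp+zU_{j*}P_{j*})\tau_{j*}^*}\oplus W_{\partial j}^*\big)\Pi_{1*},\qquad \Pi_{1*}T_{(j)}^*=\big(M^*_{\tau_{j*}(P_{j*}U_{j*}^*+zP_{j*}^\perp U_{j*}^*)\tau_{j*}^*}\oplus W_{(\partial j)}^*\big)\Pi_{1*}.$$ Moreover $P_{j*}'=\tau_{j*}P_{j*}\tau_{j*}^*$ are orthogonal projections, $U_{j*}'=\tau_{j*}U_{j*}\tau_{j*}^*$ are unitary, and the $d$-tuple of (in general noncommuting) isometries $$\big(M_{U_{j*}'P_{j*}'^{\perp}+zU_{j*}'P_{j*}'}\oplus W_{\partial j}\big)_{j=1}^d$$ is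 a lift of $(T_1,\dots,T_d)$ via the isometric embedding $\Pi_{1*}$. -/

import Mathlib

open scoped InnerProduct ENNReal
open Filter Topology

noncomputable section

namespace BCLLift

variable {H K F G R : Type*}
variable [NormedAddCommGroup H] [InnerProductSpace ℂ H] [CompleteSpace H]
variable [NormedAddCommGroup K] [InnerProductSpace ℂ K] [CompleteSpace K]
variable [NormedAddCommGroup F] [InnerProductSpace ℂ F] [CompleteSpace F]
variable [NormedAddCommGroup G] [InnerProductSpace ℂ G] [CompleteSpace G]
variable [NormedAddCommGroup R] [InnerProductSpace ℂ R] [CompleteSpace R]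

/-! ### Tuples of commuting contractions -/

/-- A `d`-tuple of pairwise commuting contractions. -/
structure IsCommContractiveTuple {d : ℕ} (T : Fin d → H →L[ℂ] H) : Prop where
  comm : ∀ i j, T i * T j = T j * T i
  contr : ∀ i, ‖T i‖ ≤ 1

/-- The adjoint tuple `(T₁*, …, T_d*)`. -/
def adjTuple {d : ℕ} (T : Fin d → H →L[ℂ] H) : Fin d → H →L[ℂ] H := fun i => (T i)†

/-- The product of the `T i` with `i ∈ s`, taken in increasing order of the index. -/
def subProd {d : ℕ} (T : Fin d → H →L[ℂ] H) (s : Finset (Fin d)) : H →L[ℂ] H :=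
  (((List.finRange d).filter (fun i => i ∈ s)).map T).prod

/-- `T = T₁ ⋯ T_d`. -/
def fullProd {d : ℕ} (T : Fin d → H →L[ℂ] H) : H →L[ℂ] H := subProd T Finset.univ

/-- `T_(j) = T₁ ⋯ T_{j-1} T_{j+1} ⋯ T_d`. -/
def omitProd {d : ℕ} (T : Fin d → H →L[ℂ] H) (j : Fin d) : H →L[ℂ] H :=
  subProd T (Finset.univ.filter (fun k => k ≠ j))

theorem norm_listProd_le_one (l : List (H →L[ℂ] H)) (hl : ∀ A ∈ l, ‖A‖ ≤ 1) :
    ‖l.prod‖ ≤ 1 := by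
  induction l with
  | nil => exact ContinuousLinearMap.norm_id_le (𝕜 := ℂ) (E := H)
  | cons A l ih =>
    rw [List.prod_cons]
    have h1 : ‖A‖ ≤ 1 := hl A (by simp)
    have h2 : ‖l.prod‖ ≤ 1 := ih (fun B hB => hl B (by simp [hB]))
    calc ‖A * l.prod‖ ≤ ‖A‖ * ‖l.prod‖ := norm_mul_le _ _
      _ ≤ 1 := mul_le_one₀ h1 (norm_nonneg _) h2

theorem IsCommContractiveTuple.norm_fullProd_le {d : ℕ} {T : Fin d → H →L[ℂ] H}
    (hT : IsCommContractiveTuple T) : ‖fullProd T‖ ≤ 1 := by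
  apply norm_listProd_le_one
  intro A hA
  obtain ⟨i, -, rfl⟩ := List.mem_map.mp hA
  exact hT.contr i

theorem IsCommContractiveTuple.adj {d : ℕ} {T : Fin d → H →L[ℂ] H}
    (hT : IsCommContractiveTuple T) : IsCommContractiveTuple (adjTuple T) where
  comm i j := by
    have h := congrArg star (hT.comm j i)
    rw [star_mul, star_mul] at h
    exact h
  contr i := by
    have : ‖(T i)†‖ = ‖T i‖ := by simp
    exact this.trans_le (hT.contr i)

/-! ### Defect operators -/

/-- The defect operator `D_S = (I - S* S)^{1/2}`. -/
def defect (S : H →L[ℂ] H) : H →L[ℂ] H := CFC.sqrt (1 - S† * S)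

/-- The defect space `𝒟_S`, the closure of the range of `D_S`. -/
abbrev defectSpace (S : H →L[ℂ] H) : Submodule ℂ H :=
  (LinearMap.range (defect S).toLinearMap).topologicalClosure

instance (S : H →L[ℂ] H) : CompleteSpace (defectSpace S) :=
  (Submodule.isClosed_topologicalClosure _).completeSpace_coe

/-- An operator, regarded as a map into the closure of its range. -/
def toRangeClosure (A : H →L[ℂ] K) :
    H →L[ℂ] (LinearMap.range A.toLinearMap).topologicalClosure :=
  A.codRestrict _ (fun h => Submodule.le_topologicalClosure _ (LinearMap.mem_range_self _ h))

/-- `D_S` regarded as a map `H → 𝒟_S`. -/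
def defectMap (S : H →L[ℂ] H) : H →L[ℂ] defectSpace S := toRangeClosure (defect S)

theorem norm_defect_sq (S : H →L[ℂ] H) (hS : ‖S‖ ≤ 1) (h : H) :
    ‖defect S h‖ ^ 2 = ‖h‖ ^ 2 - ‖S h‖ ^ 2 := by
  have key : ∀ x, inner ℂ ((1 - S† * S) x) x = ((‖x‖ ^ 2 - ‖S x‖ ^ 2 : ℝ) : ℂ) := by
    intro x
    have e : (1 - S† * S) x = x - (S†) (S x) := rfl
    rw [e, inner_sub_left, ContinuousLinearMap.adjoint_inner_left,
      inner_self_eq_norm_sq_to_K, inner_self_eq_norm_sq_to_K]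
    push_cast
    rfl
  have hpos : (0 : H →L[ℂ] H) ≤ 1 - S† * S := by
    rw [ContinuousLinearMap.nonneg_iff_isPositive]
    refine (ContinuousLinearMap.isPositive_iff_complex _).mpr fun x => ?_
    rw [key x]
    have h1 : ‖S x‖ ≤ ‖x‖ := by
      simpa using S.le_of_opNorm_le hS x
    have h2 := pow_le_pow_left₀ (norm_nonneg _) h1 2
    exact ⟨rfl, sub_nonneg.mpr h2⟩
  have hsa : (defect S)† = defect S := by
    have : IsSelfAdjoint (defect S) := (CFC.sqrt_nonneg (1 - S† * S)).isSelfAdjoint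
    exact this
  have hsq : defect S * defect S = 1 - S† * S := CFC.sqrt_mul_sqrt_self _ hpos
  have e1 : inner ℂ (defect S h) (defect S h) = inner ℂ ((1 - S† * S) h) h := by
    rw [← hsq, ← ContinuousLinearMap.adjoint_inner_left, hsa]; rfl
  rw [key, inner_self_eq_norm_sq_to_K] at e1
  have e2 : ((‖defect S h‖ ^ 2 : ℝ) : ℂ) = ((‖h‖ ^ 2 - ‖S h‖ ^ 2 : ℝ) : ℂ) := by
    rw [← e1]; push_cast; rfl
  exact Complex.ofReal_injective e2

/-! ### Hardy spaces and multiplication by linear pencils -/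

/-- The Hardy space `H²(F)`: power series `∑ zⁿ fₙ` with coefficients in `F` and
`∑ ‖fₙ‖² < ∞`, represented by the sequence of coefficients. -/
abbrev Hardy (F : Type*) [NormedAddCommGroup F] : Type _ := lp (fun _ : ℕ => F) 2

/-- The value at `z` of the power series `∑ zⁿ fₙ`. -/
def Hardy.eval (f : Hardy F) (z : ℂ) : F := ∑' n : ℕ, z ^ n • f n

/-- `I_{H²} ⊗ A`, which applies `A` to every coefficient. -/
def Hardy.map (A : F →L[ℂ] G) : Hardy F →L[ℂ] Hardy G :=
  lp.mapCLM 2 (fun _ : ℕ => A) (K := ‖A‖) (norm_nonneg _) (fun _ => le_rfl)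

@[simp] theorem Hardy.map_apply (A : F →L[ℂ] G) (f : Hardy F) (n : ℕ) :
    Hardy.map A f n = A (f n) := rfl

theorem memℓp_shift (f : Hardy F) :
    Memℓp (fun n : ℕ => Nat.casesOn (motive := fun _ => F) n 0 (fun k => f k)) 2 := by
  have hf := (memℓp_gen_iff (by simp : (0 : ℝ) < (2 : ℝ≥0∞).toReal)).mp (lp.memℓp f)
  refine memℓp_gen ?_
  rw [← summable_nat_add_iff 1]
  exact hf

theorem norm_hardy_sq (f : Hardy F) : ‖f‖ ^ 2 = ∑' n, ‖f n‖ ^ 2 := by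
  have := lp.norm_rpow_eq_tsum (by simp : (0 : ℝ) < (2 : ℝ≥0∞).toReal) f
  simpa using this

theorem summable_hardy_sq (f : Hardy F) : Summable fun n => ‖f n‖ ^ 2 := by
  have := (memℓp_gen_iff (by simp : (0 : ℝ) < (2 : ℝ≥0∞).toReal)).mp (lp.memℓp f)
  simpa using this

/-- The operator `M_z` of multiplication by the variable on `H²(F)`. -/
def Hardy.shift : Hardy F →L[ℂ] Hardy F :=
  LinearMap.mkContinuous
    { toFun := fun f => ⟨fun n => Nat.casesOn (motive := fun _ => F) n 0 (fun k => f k),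
        memℓp_shift f⟩
      map_add' := by
        intro f g
        ext n
        cases n with
        | zero => exact (add_zero (0 : F)).symm
        | succ n => rfl
      map_smul' := by
        intro c f
        ext n
        cases n with
        | zero => exact (smul_zero (A := F) c).symm
        | succ n => rfl }
    1
    (by
      intro f
      rw [one_mul]
      refine (pow_le_pow_iff_left₀ (norm_nonneg _) (norm_nonneg _) two_ne_zero).mp ?_
      rw [norm_hardy_sq, norm_hardy_sq, (summable_hardy_sq _).tsum_eq_zero_add]
      refine le_of_eq ?_
      change ‖(0 : F)‖ ^ 2 + ∑' n, ‖f n‖ ^ 2 = _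
      simp)

@[simp] theorem Hardy.shift_zero (f : Hardy F) : Hardy.shift f 0 = 0 := rfl

@[simp] theorem Hardy.shift_succ (f : Hardy F) (n : ℕ) : Hardy.shift f (n + 1) = f n := rfl

/-- The operator `M_{A + zB}` of multiplication by the pencil `z ↦ A + zB` on `H²(F)`. -/
def Hardy.mulPencil (A B : F →L[ℂ] F) : Hardy F →L[ℂ] Hardy F :=
  Hardy.map A + Hardy.shift * Hardy.map B

theorem Hardy.summable_eval (f : Hardy F) {z : ℂ} (hz : ‖z‖ < 1) :
    Summable fun n : ℕ => z ^ n • f n := by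
  refine Summable.of_norm_bounded (g := fun n : ℕ => ‖z‖ ^ n * ‖f‖)
    ((summable_geometric_of_lt_one (norm_nonneg _) hz).mul_right _) fun n => ?_
  rw [norm_smul, norm_pow]
  exact mul_le_mul_of_nonneg_left (lp.norm_apply_le_norm two_ne_zero f n) (by positivity)

/-- `M_{A + zB}` is pointwise multiplication by `A + zB` on the unit disk. -/
theorem Hardy.eval_mulPencil (A B : F →L[ℂ] F) (f : Hardy F) {z : ℂ} (hz : ‖z‖ < 1) :
    Hardy.eval (Hardy.mulPencil A B f) z = (A + z • B) (Hardy.eval f z) := by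
  have h1 : ∀ C : F →L[ℂ] F, Hardy.eval (Hardy.map C f) z = C (Hardy.eval f z) := by
    intro C
    have := (C.hasSum (Hardy.summable_eval f hz).hasSum).tsum_eq
    simpa [Hardy.eval] using this
  have h2 : ∀ g : Hardy F, Hardy.eval (Hardy.shift g) z = z • Hardy.eval g z := by
    intro g
    rw [Hardy.eval, (Hardy.summable_eval _ hz).tsum_eq_zero_add, Hardy.eval,
      ← (Hardy.summable_eval g hz).tsum_const_smul]
    simp [pow_succ', mul_smul]
  have h3 : Hardy.eval (Hardy.mulPencil A B f) z =
      Hardy.eval (Hardy.map A f) z + Hardy.eval (Hardy.shift (Hardy.map B f)) z := by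
    rw [Hardy.eval, Hardy.eval, Hardy.eval,
      ← (Hardy.summable_eval _ hz).tsum_add (Hardy.summable_eval _ hz)]
    refine tsum_congr fun n => ?_
    rw [← smul_add]
    rfl
  rw [h3, h2, h1, h1]
  simp

/-! ### The observability operator -/

theorem memℓp_observability (S : H →L[ℂ] H) (hS : ‖S‖ ≤ 1) (h : H) :
    Memℓp (fun n : ℕ => defectMap S ((S ^ n) h)) 2 := by
  refine memℓp_gen' (C := ‖h‖ ^ 2) fun s => ?_
  have h0 : ∀ n : ℕ, ‖defectMap S ((S ^ n) h)‖ ^ (2 : ℝ≥0∞).toReal =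
      ‖(S ^ n) h‖ ^ 2 - ‖(S ^ (n + 1)) h‖ ^ 2 := by
    intro n
    have e : ‖defectMap S ((S ^ n) h)‖ = ‖defect S ((S ^ n) h)‖ := rfl
    have e2 : (S ^ (n + 1)) h = S ((S ^ n) h) := by rw [pow_succ']; rfl
    rw [e, e2, ← norm_defect_sq S hS]
    simp
  obtain ⟨N, hN⟩ := s.exists_nat_subset_range
  refine (Finset.sum_le_sum_of_subset_of_nonneg hN fun _ _ _ => by positivity).trans ?_
  rw [Finset.sum_congr rfl fun n _ => h0 n, Finset.sum_range_sub']
  simp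

theorem tsum_observability_le (S : H →L[ℂ] H) (hS : ‖S‖ ≤ 1) (h : H) :
    ‖(⟨_, memℓp_observability S hS h⟩ : Hardy (defectSpace S))‖ ≤ ‖h‖ := by
  refine (pow_le_pow_iff_left₀ (norm_nonneg _) (norm_nonneg _) two_ne_zero).mp ?_
  rw [norm_hardy_sq]
  refine Real.tsum_le_of_sum_range_le (fun _ => by positivity) fun N => ?_
  have h0 : ∀ n : ℕ, ‖defectMap S ((S ^ n) h)‖ ^ 2 =
      ‖(S ^ n) h‖ ^ 2 - ‖(S ^ (n + 1)) h‖ ^ 2 := by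
    intro n
    have e2 : (S ^ (n + 1)) h = S ((S ^ n) h) := by rw [pow_succ']; rfl
    rw [e2, ← norm_defect_sq S hS]
    rfl
  refine (Finset.sum_congr rfl fun n _ => h0 n).trans_le ?_
  rw [Finset.sum_range_sub']
  simp

/-- For a contraction `S`, the observability operator `h ↦ ∑ zⁿ D_S Sⁿ h` from `H` to
`H²(𝒟_S)`. -/
def observability (S : H →L[ℂ] H) (hS : ‖S‖ ≤ 1) : H →L[ℂ] Hardy (defectSpace S) :=
  LinearMap.mkContinuous
    { toFun := fun h => ⟨fun n => defectMap S ((S ^ n) h), memℓp_observability S hS h⟩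
      map_add' := by
        intro f g
        ext n : 2
        exact ((congrArg (defectMap S) (map_add (S ^ n) f g)).trans (map_add _ _ _))
      map_smul' := by
        intro c f
        ext n : 2
        exact ((congrArg (defectMap S) (map_smul (S ^ n) c f)).trans (map_smul _ _ _)) }
    1
    (by
      intro h
      rw [one_mul]
      exact tsum_observability_le S hS h)

/-! ### The operator `Q` and the canonical commutative unitary tuple -/

/-- The limit of a sequence of operators in the strong operator topology
(and `0` if there is none). -/
def sotLim (A : ℕ → H →L[ℂ] H) : H →L[ℂ] H :=
  open Classical in
  if hA : ∃ L : H →L[ℂ] H, ∀ h, Tendsto (fun n => A n h) atTop (𝓝 (L h)) then hA.choose else 0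

/-- For a contraction `T` the strong limit of `Tⁿ T*ⁿ` exists. -/
theorem tendsto_sotLim (T : H →L[ℂ] H) (hT : ‖T‖ ≤ 1) (h : H) :
    Tendsto (fun n => (T ^ n * T† ^ n) h) atTop
      (𝓝 (sotLim (fun n => T ^ n * T† ^ n) h)) := by
  have hTs : ‖T†‖ ≤ 1 := by simpa using hT
  have hpow : ∀ (A : H →L[ℂ] H), ‖A‖ ≤ 1 → ∀ n x, ‖(A ^ n) x‖ ≤ ‖x‖ := by
    intro A hA n x
    induction n with
    | zero => simp
    | succ n ih =>
      have e2 : (A ^ (n + 1)) x = A ((A ^ n) x) := by rw [pow_succ']; rfl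
      rw [e2]
      refine (A.le_of_opNorm_le hA _).trans ?_
      simpa using ih
  have hadj : ∀ n, (T ^ n)† = T† ^ n := fun n => star_pow T n
  -- one-step estimate
  have hdiff : ∀ k x, ‖x - (T ^ k * T† ^ k) x‖ ^ 2 ≤ ‖x‖ ^ 2 - ‖(T† ^ k) x‖ ^ 2 := by
    intro k x
    have e : (T ^ k * T† ^ k) x = (T ^ k) ((T† ^ k) x) := rfl
    have e1 : RCLike.re (inner ℂ x ((T ^ k) ((T† ^ k) x))) = ‖(T† ^ k) x‖ ^ 2 := by
      rw [← ContinuousLinearMap.adjoint_inner_left, hadj, inner_self_eq_norm_sq]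
    rw [@norm_sub_sq ℂ, e, e1]
    have := pow_le_pow_left₀ (norm_nonneg _) (hpow T hT k ((T† ^ k) x)) 2
    linarith
  have hstep : ∀ m k x, ‖(T ^ m * T† ^ m) x - (T ^ (m + k) * T† ^ (m + k)) x‖ ^ 2 ≤
      ‖(T† ^ m) x‖ ^ 2 - ‖(T† ^ (m + k)) x‖ ^ 2 := by
    intro m k x
    have e : (T ^ m * T† ^ m) x - (T ^ (m + k) * T† ^ (m + k)) x =
        (T ^ m) ((T† ^ m) x - (T ^ k * T† ^ k) ((T† ^ m) x)) := by
      rw [map_sub, pow_add T m k, add_comm m k, pow_add (T†) k m]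
      rfl
    have e2 : (T† ^ (m + k)) x = (T† ^ k) ((T† ^ m) x) := by
      rw [add_comm, pow_add]; rfl
    rw [e, e2]
    exact (pow_le_pow_left₀ (norm_nonneg _) (hpow T hT m _) 2).trans (hdiff k _)
  have hcauchy : ∀ x, CauchySeq fun n => (T ^ n * T† ^ n) x := by
    intro x
    have hanti : Antitone fun n => ‖(T† ^ n) x‖ ^ 2 := by
      refine antitone_nat_of_succ_le fun n => ?_
      have := (sq_nonneg _).trans (hstep n 1 x)
      linarith
    have hbdd : BddBelow (Set.range fun n => ‖(T† ^ n) x‖ ^ 2) :=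
      ⟨0, by rintro _ ⟨n, rfl⟩; positivity⟩
    have hc := (tendsto_atTop_ciInf hanti hbdd).cauchySeq
    rw [Metric.cauchySeq_iff'] at hc ⊢
    intro ε hε
    obtain ⟨N, hN⟩ := hc (ε ^ 2) (by positivity)
    refine ⟨N, fun n hn => ?_⟩
    obtain ⟨k, rfl⟩ := Nat.exists_eq_add_of_le hn
    have h1 := hN (N + k) hn
    rw [dist_comm, Real.dist_eq] at h1
    rw [dist_comm, dist_eq_norm]
    refine lt_of_pow_lt_pow_left₀ 2 hε.le ?_
    exact (hstep N k x).trans_lt ((le_abs_self _).trans_lt h1)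
  have hex : ∃ L : H →L[ℂ] H, ∀ x, Tendsto (fun n => (T ^ n * T† ^ n) x) atTop (𝓝 (L x)) := by
    choose f hf using fun x => cauchySeq_tendsto_of_complete (hcauchy x)
    exact ⟨continuousLinearMapOfTendsto (fun n => T ^ n * T† ^ n) (tendsto_pi_nhds.mpr hf), hf⟩
  rw [sotLim, dif_pos hex]
  exact hex.choose_spec h

/-- `Q`, the positive square root of the strong limit of `Tⁿ T*ⁿ`. -/
def asympQ (T : H →L[ℂ] H) : H →L[ℂ] H := CFC.sqrt (sotLim fun n => T ^ n * T† ^ n)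

/-- The closure of the range of `Q`. -/
abbrev asympSpace (T : H →L[ℂ] H) : Submodule ℂ H :=
  (LinearMap.range (asympQ T).toLinearMap).topologicalClosure

instance (T : H →L[ℂ] H) : CompleteSpace (asympSpace T) :=
  (Submodule.isClosed_topologicalClosure _).completeSpace_coe

/-- `Q` regarded as a map from `H` to the closure of its range. -/
def asympMap (T : H →L[ℂ] H) : H →L[ℂ] asympSpace T := toRangeClosure (asympQ T)

/-- The operator `X` on the closure of `Ran Q` determined by continuity and `X Q h = Q A h`. -/
def asympCompress (T A : H →L[ℂ] H) : asympSpace T →L[ℂ] asympSpace T :=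
  (asympMap T ∘L A).toLinearMap.extendOfNorm (asympMap T).toLinearMap

/-- `U` on `R` is a minimal unitary extension of the isometry `V` on `K`, where `K` is
identified with a subspace of `R` through the isometry `ι`. -/
structure IsMinimalUnitaryExtension (V : K →L[ℂ] K) (ι : K →ₗᵢ[ℂ] R) (U : R →L[ℂ] R) : Prop where
  isUnitary : U ∈ unitary (R →L[ℂ] R)
  extends_ : ∀ x, U (ι x) = ι (V x)
  minimal : (Submodule.span ℂ {y : R | ∃ (n : ℕ) (x : K), y = ((U†) ^ n) (ι x)}).topologicalClosure
    = ⊤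

/-- `W = (W₁, …, W_d)` on `R` is (a realization of) the canonical commutative unitary tuple
associated with the commutative contractive tuple `T`, with `W_D = W₁ ⋯ W_d`: the space `R`
contains (through `ι`) the closure of `Ran Q`, `W_D*` is a minimal unitary extension of the isometry
`X*` given by `X* Q = Q (T₁ ⋯ T_d)*`, and `(W₁*, …, W_d*)` is a commutative unitary extension of
`(X₁*, …, X_d*)` with `X_j* Q = Q T_j*`. -/
structure IsCanonicalUnitaryTuple {d : ℕ} (T : Fin d → H →L[ℂ] H)
    (ι : asympSpace (fullProd T) →ₗᵢ[ℂ] R) (W : Fin d → R →L[ℂ] R) (WD : R →L[ℂ] R) : Prop where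
  isUnitary : ∀ j, W j ∈ unitary (R →L[ℂ] R)
  comm : ∀ i j, W i * W j = W j * W i
  extends_ : ∀ j x, ((W j)†) (ι x) = ι (asympCompress (fullProd T) ((T j)†) x)
  minimal : IsMinimalUnitaryExtension (asympCompress (fullProd T) ((fullProd T)†)) ι (WD†)
  prod_eq : WD = fullProd W

/-! ### Andô tuples -/

/-- The space `𝒟_{T₁} ⊕ ⋯ ⊕ 𝒟_{T_d} ⊕ E`. -/
abbrev AndoSpace {d : ℕ} (T : Fin d → H →L[ℂ] H) (E : Type*) : Type _ :=
  WithLp 2 (PiLp 2 (fun i => defectSpace (T i)) × E)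

section Ando

variable {E : Type*} [NormedAddCommGroup E] [InnerProductSpace ℂ E] [CompleteSpace E]

/-- The operator into `𝒟_{T₁} ⊕ ⋯ ⊕ 𝒟_{T_d} ⊕ E` with components `B₁, …, B_d, 0`. -/
def AndoSpace.column {d : ℕ} (T : Fin d → H →L[ℂ] H) (E : Type*) [NormedAddCommGroup E]
    [InnerProductSpace ℂ E] (B : ∀ i, K →L[ℂ] defectSpace (T i)) : K →L[ℂ] AndoSpace T E :=
  (WithLp.prodContinuousLinearEquiv 2 ℂ _ _).symm.toContinuousLinearMap ∘L
    (((PiLp.continuousLinearEquiv 2 ℂ _).symm.toContinuousLinearMap ∘L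
      ContinuousLinearMap.pi B).prod 0)

/-- `P_j`, the projection of `𝒟_{T₁} ⊕ ⋯ ⊕ 𝒟_{T_d} ⊕ E` onto its summand `𝒟_{T_j}`. -/
def andoProj {d : ℕ} (T : Fin d → H →L[ℂ] H) (E : Type*) [NormedAddCommGroup E]
    [InnerProductSpace ℂ E] (j : Fin d) : AndoSpace T E →L[ℂ] AndoSpace T E :=
  AndoSpace.column T E fun i =>
    if i = j then PiLp.proj 2 (fun i => defectSpace (T i)) i ∘L WithLp.fstL 2 ℂ _ _ else 0

/-- `h ↦ D_{T_j} T_(j) h ⊕ Δ_(j) D_{T_(j)} h`, where the component of `Δ_(j) D_{T_(j)} h` in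
`𝒟_{T_i}`, `i ≠ j`, is `D_{T_i} (∏_{k > i, k ≠ j} T_k) h`. -/
def andoSource {d : ℕ} (T : Fin d → H →L[ℂ] H) (E : Type*) [NormedAddCommGroup E]
    [InnerProductSpace ℂ E] (j : Fin d) : H →L[ℂ] AndoSpace T E :=
  AndoSpace.column T E fun i => defectMap (T i) ∘L
    (if i = j then omitProd T j else subProd T (Finset.univ.filter fun k => i < k ∧ k ≠ j))

/-- `h ↦ D_{T_j} h ⊕ Δ_(j) D_{T_(j)} T_j h`. -/
def andoTarget {d : ℕ} (T : Fin d → H →L[ℂ] H) (E : Type*) [NormedAddCommGroup E]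
    [InnerProductSpace ℂ E] (j : Fin d) : H →L[ℂ] AndoSpace T E :=
  AndoSpace.column T E fun i => defectMap (T i) ∘L
    (if i = j then 1 else subProd T (Finset.univ.filter fun k => i < k ∧ k ≠ j) * T j)

/-- `Λ_j : 𝒟_T → 𝒟_{T₁} ⊕ ⋯ ⊕ 𝒟_{T_d} ⊕ E`, determined by continuity and
`Λ_j D_T h = D_{T_j} T_(j) h ⊕ Δ_(j) D_{T_(j)} h`, where `T = T₁ ⋯ T_d`. -/
def andoLambda {d : ℕ} (T : Fin d → H →L[ℂ] H) (E : Type*) [NormedAddCommGroup E]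
    [InnerProductSpace ℂ E] [CompleteSpace E] (j : Fin d) :
    defectSpace (fullProd T) →L[ℂ] AndoSpace T E :=
  (andoSource T E j).toLinearMap.extendOfNorm (defectMap (fullProd T)).toLinearMap

/-- `(𝒟_{T₁} ⊕ ⋯ ⊕ 𝒟_{T_d} ⊕ E, Λ_j, P_j, U_j)` is an Andô tuple for `T`: each `U_j` is unitary
and `U_j*` extends the isometry
`D_{T_j} T_(j) h ⊕ Δ_(j) D_{T_(j)} h ↦ D_{T_j} h ⊕ Δ_(j) D_{T_(j)} T_j h`. -/
structure IsAndoTuple {d : ℕ} (T : Fin d → H →L[ℂ] H)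
    (U : Fin d → AndoSpace T E →L[ℂ] AndoSpace T E) : Prop where
  isUnitary : ∀ j, U j ∈ unitary (AndoSpace T E →L[ℂ] AndoSpace T E)
  extends_ : ∀ j h, ((U j)†) (andoSource T E j h) = andoTarget T E j h

end Ando

/-! ### Lifts and BCL models -/

/-- The orthogonal direct sum `A ⊕ B` of two operators. -/
def dirSum (A : F →L[ℂ] F) (B : R →L[ℂ] R) : WithLp 2 (F × R) →L[ℂ] WithLp 2 (F × R) :=
  (WithLp.prodContinuousLinearEquiv 2 ℂ F R).symm.toContinuousLinearMap ∘L
    (A.prodMap B) ∘L (WithLp.prodContinuousLinearEquiv 2 ℂ F R).toContinuousLinearMap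

/-- `M_{U P^⊥ + z U P}` on `H²(F)`. -/
def bclMul (U P : F →L[ℂ] F) : Hardy F →L[ℂ] Hardy F :=
  Hardy.mulPencil (U * (1 - P)) (U * P)

/-- The companion `M_{P U* + z P^⊥ U*}` on `H²(F)`. -/
def bclCoMul (U P : F →L[ℂ] F) : Hardy F →L[ℂ] Hardy F :=
  Hardy.mulPencil (P * U†) ((1 - P) * U†)

/-- `(Π, S)` is a lift of `T`. -/
def IsLift {κ : Type*} (Pi : H →L[ℂ] K) (S : κ → K →L[ℂ] K) (T : κ → H →L[ℂ] H) : Prop :=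
  Isometry Pi ∧ ∀ j h, ((S j)†) (Pi h) = Pi (((T j)†) h)

/-- `(Π, S)` is a lift of `T` consisting of isometries (not assumed to commute). -/
def IsIsometricLift {κ : Type*} (Pi : H →L[ℂ] K) (S : κ → K →L[ℂ] K) (T : κ → H →L[ℂ] H) :
    Prop :=
  IsLift Pi S T ∧ ∀ j, Isometry (S j)

/-- The map `Π_{j*} h = (I_{H²} ⊗ Λ_{j*}) (∑ zⁿ D_{T*} T*ⁿ h) ⊕ Q h` from `H` to `H²(F_*) ⊕ R`, where
`F_* = 𝒟_{T₁*} ⊕ ⋯ ⊕ 𝒟_{T_d*} ⊕ E`, the space `R` contains the closure of `Ran Q` through `ι`, and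
`T* = T₁* ⋯ T_d*`. -/
def liftEmbedding {d : ℕ} {T : Fin d → H →L[ℂ] H} (hT : IsCommContractiveTuple T)
    (E : Type*) [NormedAddCommGroup E] [InnerProductSpace ℂ E] [CompleteSpace E]
    (ι : asympSpace (fullProd T) →ₗᵢ[ℂ] R) (j : Fin d) :
    H →L[ℂ] WithLp 2 (Hardy (AndoSpace (adjTuple T) E) × R) :=
  (WithLp.prodContinuousLinearEquiv 2 ℂ _ _).symm.toContinuousLinearMap ∘L
    ((Hardy.map (andoLambda (adjTuple T) E j) ∘L
        observability (fullProd (adjTuple T)) hT.adj.norm_fullProd_le).prod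
      (ι.toContinuousLinearMap ∘L asympMap (fullProd T)))

end BCLLift

end

/-!
Write `S_i = T_i*` and `S = S_1 ⋯ S_d = T*`. The operators
`Π_j h = (∑ zⁿ Λ_j D_S Sⁿ h) ⊕ Q h` are isometric and intertwine because everything can be read off
coefficient by coefficient.

* The defects of the factors of a commuting product telescope (`sum_norm_defect_sq`), which gives
  `‖andoSource j h‖ = ‖D_S h‖`. Hence `Λ_j` is a well-defined isometry with
  `Λ_j D_S h = andoSource j h` (`andoLambda_defectMap`), and the `n`-th coefficient of `Π_j h` is
  `andoSource j (Sⁿ h)`.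
* `‖Q h‖² = lim ‖Sⁿ h‖²` (`tendsto_norm_sq_adjoint_pow`), while the Hardy component of `Π_j h` has
  squared norm `∑ (‖Sⁿ h‖² - ‖Sⁿ⁺¹ h‖²) = ‖h‖² - lim ‖Sⁿ h‖²`. So `Π_j` is an isometry.
* The adjoint of multiplication by `A + zB` sends the coefficient sequence `(f_n)` to
  `(A* f_n + B* f_{n+1})`. An intertwining relation `Π_j C = (M* ⊕ V*) Π_j` with `C` commuting with
  `S` therefore reduces to `A* andoSource j h + B* andoSource j (S h) = andoSource j (C h)`
  (`liftEmbedding_comp`). For the two pencils built from `(U_j, P_j)` this follows by comparing the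
  components of `andoSource j` and `andoTarget j = U_j* andoSource j`
  (`IsAndoTuple.adjoint_bclMul_source`, `IsAndoTuple.adjoint_bclCoMul_source`).
* On the unitary summand, `‖Q A h‖ ≤ ‖Q h‖` for contractions `A` commuting with `S`, so the
  operators `X_j*` exist with `X_j* Q = Q T_j*` (`asympCompress_asympMap`).
* Multiplication by `A + zB` is isometric as soon as `A*A + B*B = 1` and `A*B = 0`
  (`Hardy.adjoint_mulPencil_mul_mulPencil`), which holds for all the pencils in question.

Conjugation by a unitary `τ_j` with `τ_j Λ_j = Λ_1` carries the coefficient identities for `Λ_j` to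
those for `Λ_1`, which replaces the embeddings `Π_j` by the single embedding `Π_1`.
-/

open scoped InnerProduct ENNReal
open Filter Topology

noncomputable section

set_option linter.unusedSectionVars false

namespace BCLLift

variable {H K F G R : Type*}
variable [NormedAddCommGroup H] [InnerProductSpace ℂ H] [CompleteSpace H]
variable [NormedAddCommGroup K] [InnerProductSpace ℂ K] [CompleteSpace K]
variable [NormedAddCommGroup F] [InnerProductSpace ℂ F] [CompleteSpace F]
variable [NormedAddCommGroup G] [InnerProductSpace ℂ G] [CompleteSpace G]
variable [NormedAddCommGroup R] [InnerProductSpace ℂ R] [CompleteSpace R]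

/-! ### Products over a commuting tuple -/

section Products

variable {d : ℕ}

theorem subProd_eq_of_perm {T : Fin d → H →L[ℂ] H} (hT : ∀ i j, T i * T j = T j * T i)
    {s : Finset (Fin d)} {l : List (Fin d)} (hl : l.Nodup) (hs : ∀ i, i ∈ l ↔ i ∈ s) :
    subProd T s = (l.map T).prod := by
  have hp : ((List.finRange d).filter (fun i => i ∈ s)).Perm l := by
    refine (List.perm_ext_iff_of_nodup ((List.nodup_finRange d).filter _) hl).mpr fun i => ?_
    simp [hs]
  refine (hp.map T).prod_eq' (List.pairwise_of_forall_mem_list ?_)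
  intro a ha b hb
  obtain ⟨i, -, rfl⟩ := List.mem_map.mp ha
  obtain ⟨j, -, rfl⟩ := List.mem_map.mp hb
  exact hT i j

theorem subProd_empty (T : Fin d → H →L[ℂ] H) : subProd T ∅ = 1 := by
  simp [subProd]

theorem subProd_insert {T : Fin d → H →L[ℂ] H} (hT : ∀ i j, T i * T j = T j * T i)
    {s : Finset (Fin d)} {a : Fin d} (ha : a ∉ s) :
    subProd T (insert a s) = T a * subProd T s := by
  rw [subProd_eq_of_perm hT (l := a :: (List.finRange d).filter (fun i => i ∈ s))]
  · rw [List.map_cons, List.prod_cons]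
    rfl
  · exact List.nodup_cons.mpr ⟨by simp [ha], (List.nodup_finRange d).filter _⟩
  · simp

theorem subProd_commute {T : Fin d → H →L[ℂ] H} {A : H →L[ℂ] H} (hA : ∀ i, Commute A (T i))
    (s : Finset (Fin d)) : Commute A (subProd T s) := by
  refine Commute.list_prod_right _ _ fun B hB => ?_
  obtain ⟨i, -, rfl⟩ := List.mem_map.mp hB
  exact hA i

theorem fullProd_eq_mul_omitProd {T : Fin d → H →L[ℂ] H} (hT : ∀ i j, T i * T j = T j * T i)
    (j : Fin d) : fullProd T = T j * omitProd T j := by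
  have h : (Finset.univ : Finset (Fin d)) = insert j (Finset.univ.filter fun k => k ≠ j) := by
    ext k
    simp [em]
  rw [fullProd, h, subProd_insert hT (by simp)]
  rfl

theorem subProd_adjTuple {T : Fin d → H →L[ℂ] H} (hT : ∀ i j, T i * T j = T j * T i)
    (s : Finset (Fin d)) : subProd (adjTuple T) s = (subProd T s)† := by
  have key : ∀ l : List (Fin d), ((l.map T).prod)† = (l.reverse.map (adjTuple T)).prod := by
    intro l
    induction l with
    | nil => exact star_one (H →L[ℂ] H)
    | cons a l ih =>
      rw [List.map_cons, List.prod_cons, List.reverse_cons, List.map_append, List.prod_append,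
        ← ih]
      have : (T a * (l.map T).prod)† = ((l.map T).prod)† * (T a)† := star_mul _ _
      rw [this]
      simp [adjTuple]
  have hadj : ∀ i j, adjTuple T i * adjTuple T j = adjTuple T j * adjTuple T i := by
    intro i j
    have h := congrArg star (hT j i)
    rw [star_mul, star_mul] at h
    exact h
  rw [subProd.eq_1 T, key]
  refine subProd_eq_of_perm hadj ?_ ?_
  · exact List.nodup_reverse.mpr ((List.nodup_finRange d).filter _)
  · simp

/-- If the adjoints of `W i` act on the range of `q` as the adjoints of `T i`, then so do the
adjoints of products taken in the same order. No commutativity is involved. -/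
theorem adjoint_subProd_intertwine {T : Fin d → H →L[ℂ] H} {W : Fin d → R →L[ℂ] R} {q : H → R}
    (h : ∀ i x, ((W i)†) (q x) = q (((T i)†) x)) (s : Finset (Fin d)) (x : H) :
    ((subProd W s)†) (q x) = q (((subProd T s)†) x) := by
  unfold subProd
  generalize (List.finRange d).filter (fun i => i ∈ s) = l
  induction l generalizing x with
  | nil =>
    have h1 : ((1 : R →L[ℂ] R))† = 1 := star_one _
    have h2 : ((1 : H →L[ℂ] H))† = 1 := star_one _
    simp [h1, h2]
  | cons a l ih =>
    have h1 : (W a * (l.map W).prod)† = ((l.map W).prod)† * (W a)† := star_mul _ _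
    have h2 : (T a * (l.map T).prod)† = ((l.map T).prod)† * (T a)† := star_mul _ _
    rw [List.map_cons, List.prod_cons, List.map_cons, List.prod_cons, h1, h2,
      mul_apply_eq_comp, mul_apply_eq_comp, h, ih]

theorem subProd_mem_unitary {W : Fin d → R →L[ℂ] R} (hW : ∀ i, W i ∈ unitary (R →L[ℂ] R))
    (s : Finset (Fin d)) : subProd W s ∈ unitary (R →L[ℂ] R) := by
  refine Submonoid.list_prod_mem _ fun A hA => ?_
  obtain ⟨i, -, rfl⟩ := List.mem_map.mp hA
  exact hW i

/-- The defects of the factors of a product add up to the defect of the product: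
`∑_{i ∈ s} ‖D_{S_i} (∏_{k ∈ s, k > i} S_k) h‖² = ‖h‖² - ‖(∏_{i ∈ s} S_i) h‖²`. -/
theorem sum_norm_defect_sq {S : Fin d → H →L[ℂ] H} (hS : IsCommContractiveTuple S)
    (s : Finset (Fin d)) (h : H) :
    ∑ i ∈ s, ‖defect (S i) (subProd S (s.filter fun k => i < k) h)‖ ^ 2
      = ‖h‖ ^ 2 - ‖subProd S s h‖ ^ 2 := by
  induction s using Finset.induction_on_min with
  | empty => simp [subProd_empty]
  | insert a s ha ih =>
    have has : a ∉ s := fun h' => lt_irrefl _ (ha a h')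
    have e1 : (insert a s).filter (fun k => a < k) = s := by
      ext k
      simp only [Finset.mem_filter, Finset.mem_insert]
      constructor
      · rintro ⟨rfl | hk, hk'⟩
        · exact absurd hk' (lt_irrefl _)
        · exact hk
      · exact fun hk => ⟨Or.inr hk, ha k hk⟩
    have e2 : ∀ i ∈ s, (insert a s).filter (fun k => i < k) = s.filter fun k => i < k := by
      intro i hi
      rw [Finset.filter_insert, if_neg (ha i hi).not_gt]
    rw [Finset.sum_insert has, e1, Finset.sum_congr rfl fun i hi => by rw [e2 i hi], ih,
      norm_defect_sq _ (hS.contr a), subProd_insert hS.comm has, mul_apply_eq_comp]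
    ring

end Products

/-! ### Extension by continuity from a dense range -/

theorem denseRange_toRangeClosure (A : H →L[ℂ] K) : DenseRange (toRangeClosure A) := by
  have h : (LinearMap.range A.toLinearMap : Set K) ⊆
      ((LinearMap.range A.toLinearMap).topologicalClosure : Set K) :=
    Submodule.le_topologicalClosure _
  have h1 := (denseRange_inclusion_iff h).mpr
    (Submodule.topologicalClosure_coe (LinearMap.range A.toLinearMap)).le
  refine h1.mono ?_
  rintro _ ⟨⟨_, x, rfl⟩, rfl⟩
  exact ⟨x, rfl⟩

/-! ### Operators on the Hardy space -/

namespace Hardy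

theorem adjoint_map (A : F →L[ℂ] G) : (Hardy.map A)† = Hardy.map (A†) := by
  refine ((ContinuousLinearMap.eq_adjoint_iff _ _).mpr fun f g => ?_).symm
  rw [lp.inner_eq_tsum, lp.inner_eq_tsum]
  exact tsum_congr fun n => ContinuousLinearMap.adjoint_inner_left _ _ _

theorem map_mul (A B : F →L[ℂ] F) : Hardy.map (A * B) = Hardy.map A * Hardy.map B := rfl

theorem map_add (A B : F →L[ℂ] F) : Hardy.map (A + B) = Hardy.map A + Hardy.map B := rfl

theorem map_one : Hardy.map (1 : F →L[ℂ] F) = 1 := rfl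

theorem map_zero : Hardy.map (0 : F →L[ℂ] F) = 0 := rfl

theorem map_shift (A : F →L[ℂ] F) : Hardy.map A * Hardy.shift = Hardy.shift * Hardy.map A := by
  ext f n
  cases n with
  | zero => exact _root_.map_zero A
  | succ n => rfl

theorem adjoint_shift_apply (f : Hardy F) (n : ℕ) : ((Hardy.shift (F := F))†) f n = f (n + 1) := by
  refine ext_inner_right ℂ fun a => ?_
  have hs : Hardy.shift (lp.single 2 n a : Hardy F) = lp.single 2 (n + 1) a := by
    ext m
    cases m with
    | zero => simp [lp.single_apply]
    | succ m => simp [lp.single_apply, Pi.single_apply]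
  rw [← lp.inner_single_right, ContinuousLinearMap.adjoint_inner_left, hs,
    lp.inner_single_right]

theorem adjoint_shift_mul_shift : (Hardy.shift (F := F))† * Hardy.shift = 1 := by
  ext f n
  exact adjoint_shift_apply _ n

theorem adjoint_mulPencil (A B : F →L[ℂ] F) :
    (mulPencil A B)† = Hardy.map (A†) + Hardy.map (B†) * Hardy.shift† := by
  have : star (Hardy.map A + Hardy.shift * Hardy.map B) =
      star (Hardy.map A) + star (Hardy.map B) * star (Hardy.shift (F := F)) := by
    rw [star_add, star_mul]
  rw [← adjoint_map, ← adjoint_map]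
  exact this

theorem adjoint_mulPencil_apply (A B : F →L[ℂ] F) (f : Hardy F) (n : ℕ) :
    ((mulPencil A B)†) f n = (A†) (f n) + (B†) (f (n + 1)) := by
  rw [adjoint_mulPencil, ← adjoint_shift_apply f n]
  rfl

/-- The pencil `A + zB` is isometric on the unit circle when `A*A + B*B = 1` and `A*B = 0`,
and then multiplication by it is an isometry. -/
theorem adjoint_mulPencil_mul_mulPencil {A B : F →L[ℂ] F} (h1 : A† * A + B† * B = 1)
    (h2 : A† * B = 0) : (mulPencil A B)† * mulPencil A B = 1 := by
  have h3 : B† * A = 0 := by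
    have := congrArg star h2
    rw [star_mul, star_zero] at this
    simpa [ContinuousLinearMap.star_eq_adjoint] using this
  have e1 : Hardy.map (A†) * (shift * Hardy.map B) = 0 := by
    rw [← mul_assoc, map_shift, mul_assoc, ← map_mul, h2, map_zero, mul_zero]
  have e2 : Hardy.map (B†) * shift† * Hardy.map A = 0 := by
    ext f n
    change (B†) ((shift†) (Hardy.map A f) n) = 0
    rw [adjoint_shift_apply]
    exact congrArg (fun C : F →L[ℂ] F => C (f (n + 1))) h3
  have e3 : Hardy.map (B†) * shift† * (shift * Hardy.map B) = Hardy.map (B† * B) := by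
    rw [mul_assoc, ← mul_assoc ((shift (F := F))†), adjoint_shift_mul_shift, one_mul, map_mul]
  rw [adjoint_mulPencil, mulPencil, mul_add, add_mul, add_mul, e1, e2, e3, ← map_mul, add_zero,
    zero_add, ← map_add, h1, map_one]

end Hardy

theorem bclMul_adjoint_mul_self {U P : F →L[ℂ] F} (hU : U ∈ unitary (F →L[ℂ] F))
    (hP : IsStarProjection P) : (bclMul U P)† * bclMul U P = 1 := by
  have hs : star P = P := hP.isSelfAdjoint
  have hi : P * P = P := hP.isIdempotentElem
  have hu : star U * U = 1 := Unitary.star_mul_self_of_mem hU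
  have key : ∀ X Y : F →L[ℂ] F, star (U * X) * (U * Y) = star X * Y := by
    intro X Y
    rw [star_mul, mul_assoc, ← mul_assoc (star U), hu, one_mul]
  refine Hardy.adjoint_mulPencil_mul_mulPencil ?_ ?_
  · rw [← ContinuousLinearMap.star_eq_adjoint, ← ContinuousLinearMap.star_eq_adjoint, key, key,
      star_sub, star_one, hs, hi, hP.one_sub.isIdempotentElem.eq, sub_add_cancel]
  · rw [← ContinuousLinearMap.star_eq_adjoint, key, star_sub, star_one, hs, sub_mul, one_mul, hi,
      sub_self]

theorem bclCoMul_adjoint_mul_self {U P : F →L[ℂ] F} (hU : U ∈ unitary (F →L[ℂ] F))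
    (hP : IsStarProjection P) : (bclCoMul U P)† * bclCoMul U P = 1 := by
  have hs : star P = P := hP.isSelfAdjoint
  have hi : P * P = P := hP.isIdempotentElem
  have hu : U * star U = 1 := Unitary.mul_star_self_of_mem hU
  have key : ∀ X Y : F →L[ℂ] F, star (X * star U) * (Y * star U) = U * (star X * Y) * star U := by
    intro X Y
    rw [star_mul, star_star]
    noncomm_ring
  have h1 : (1 - P) * (1 - P) = 1 - P := hP.isIdempotentElem.one_sub
  refine Hardy.adjoint_mulPencil_mul_mulPencil ?_ ?_
  · simp only [← ContinuousLinearMap.star_eq_adjoint]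
    rw [key, key, star_sub, star_one, hs, hi, h1, ← add_mul, ← mul_add, add_sub_cancel, mul_one,
      hu]
  · simp only [← ContinuousLinearMap.star_eq_adjoint]
    rw [key, hs, mul_sub, mul_one, hi, sub_self, mul_zero, zero_mul]

/-! ### Direct sums -/

theorem adjoint_dirSum (A : F →L[ℂ] F) (B : R →L[ℂ] R) : (dirSum A B)† = dirSum (A†) (B†) := by
  refine ((ContinuousLinearMap.eq_adjoint_iff _ _).mpr fun x y => ?_).symm
  rw [WithLp.prod_inner_apply, WithLp.prod_inner_apply]
  change inner ℂ ((A†) x.fst) y.fst + inner ℂ ((B†) x.snd) y.snd =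
    inner ℂ x.fst (A y.fst) + inner ℂ x.snd (B y.snd)
  rw [ContinuousLinearMap.adjoint_inner_left, ContinuousLinearMap.adjoint_inner_left]

theorem isometry_dirSum {A : F →L[ℂ] F} {B : R →L[ℂ] R} (hA : A† * A = 1) (hB : B† * B = 1) :
    Isometry (dirSum A B) := by
  rw [ContinuousLinearMap.isometry_iff_adjoint_comp_self, adjoint_dirSum]
  change dirSum (A† * A) (B† * B) = 1
  rw [hA, hB]
  rfl

theorem isometry_dirSum_shift {B : R →L[ℂ] R} (hB : B† * B = 1) :
    Isometry (dirSum (Hardy.shift (F := F)) B) :=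
  isometry_dirSum Hardy.adjoint_shift_mul_shift hB

/-! ### The asymptotic part -/

theorem tendsto_norm_sq_adjoint_pow (T : H →L[ℂ] H) (hT : ‖T‖ ≤ 1) (h : H) :
    Tendsto (fun n => ‖(T† ^ n) h‖ ^ 2) atTop (𝓝 (‖asympMap T h‖ ^ 2)) := by
  have hadj : ∀ n, (T ^ n)† = T† ^ n := fun n => star_pow T n
  set L := sotLim fun n => T ^ n * T† ^ n with hL
  have hin : ∀ x, Tendsto (fun n => ((‖(T† ^ n) x‖ ^ 2 : ℝ) : ℂ)) atTop (𝓝 (inner ℂ (L x) x)) := by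
    intro x
    refine ((tendsto_sotLim T hT x).inner tendsto_const_nhds).congr fun n => ?_
    change inner ℂ ((T ^ n) ((T† ^ n) x)) x = _
    rw [← ContinuousLinearMap.adjoint_inner_right, hadj, inner_self_eq_norm_sq_to_K]
    push_cast
    rfl
  have hre : ∀ x, Tendsto (fun n => ‖(T† ^ n) x‖ ^ 2) atTop (𝓝 (inner ℂ (L x) x).re) := by
    intro x
    refine ((Complex.continuous_re.tendsto _).comp (hin x)).congr fun n => ?_
    exact Complex.ofReal_re _
  have hpos : 0 ≤ L := by
    rw [ContinuousLinearMap.nonneg_iff_isPositive]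
    refine (ContinuousLinearMap.isPositive_iff_complex _).mpr fun x => ⟨?_, ?_⟩
    · exact tendsto_nhds_unique ((Complex.continuous_ofReal.tendsto _).comp (hre x)) (hin x)
    · exact ge_of_tendsto' (hre x) fun n => by positivity
  have hsa : (asympQ T)† = asympQ T := (CFC.sqrt_nonneg L).isSelfAdjoint
  have hsq : asympQ T * asympQ T = L := CFC.sqrt_mul_sqrt_self _ hpos
  have e : ‖asympMap T h‖ ^ 2 = (inner ℂ (L h) h).re := by
    change ‖asympQ T h‖ ^ 2 = _
    rw [← hsq, mul_apply_eq_comp, ← ContinuousLinearMap.adjoint_inner_right, hsa]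
    exact (inner_self_eq_norm_sq (𝕜 := ℂ) _).symm
  rw [e]
  exact hre h

/-- `Q h ↦ Q A h` is contractive when `A` is a contraction commuting with `T*`, so that the
extension by continuity defining `asympCompress` satisfies its defining identity. -/
theorem asympCompress_asympMap {T A : H →L[ℂ] H} (hT : ‖T‖ ≤ 1) (hA : ‖A‖ ≤ 1)
    (hc : Commute A (T†)) (h : H) : asympCompress T A (asympMap T h) = asympMap T (A h) := by
  refine LinearMap.extendOfNorm_eq (f := (asympMap T ∘L A).toLinearMap)
    (e := (asympMap T).toLinearMap) (denseRange_toRangeClosure _) ⟨1, fun x => ?_⟩ h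
  rw [one_mul]
  refine (pow_le_pow_iff_left₀ (norm_nonneg _) (norm_nonneg _) two_ne_zero).mp ?_
  refine le_of_tendsto_of_tendsto' (tendsto_norm_sq_adjoint_pow T hT (A x))
    (tendsto_norm_sq_adjoint_pow T hT x) fun n => ?_
  have e : (T† ^ n) (A x) = A ((T† ^ n) x) :=
    congrArg (fun B : H →L[ℂ] H => B x) (hc.pow_right n).eq.symm
  rw [e]
  refine pow_le_pow_left₀ (norm_nonneg _) ?_ 2
  simpa using A.le_of_opNorm_le hA ((T† ^ n) x)

/-! ### Adjoints of products and unitary conjugates -/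

theorem adjoint_mul_of_isStarProjection (U : F →L[ℂ] F) {P : F →L[ℂ] F}
    (hP : IsStarProjection P) : (U * P)† = P * U† := by
  rw [← ContinuousLinearMap.star_eq_adjoint, star_mul, hP.isSelfAdjoint.star_eq]
  rfl

theorem adjoint_mul_one_sub (U : F →L[ℂ] F) {P : F →L[ℂ] F} (hP : IsStarProjection P) :
    (U * (1 - P))† = (1 - P) * U† :=
  adjoint_mul_of_isStarProjection U hP.one_sub

theorem adjoint_mul_adjoint (P U : F →L[ℂ] F) : (P * U†)† = U * P† := by
  have := star_mul P (star U)
  rwa [star_star] at this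

theorem adjoint_conj_apply {τ : F →L[ℂ] F} (hτ : τ ∈ unitary (F →L[ℂ] F)) (A : F →L[ℂ] F)
    {x y : F} (hxy : τ x = y) : ((τ * A * τ†)†) y = τ ((A†) x) := by
  have h1 : (τ * A * τ†)† = τ * A† * τ† := by
    have := star_mul (τ * A) (star τ)
    rw [star_star, star_mul τ A, ← mul_assoc τ] at this
    exact this
  have h2 : (τ†) (τ x) = x :=
    congrArg (fun B : F →L[ℂ] F => B x) (Unitary.star_mul_self_of_mem hτ)
  rw [h1, ← hxy, mul_apply_eq_comp, h2, mul_apply_eq_comp]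

theorem isStarProjection_conj {τ P : F →L[ℂ] F} (hτ : τ ∈ unitary (F →L[ℂ] F))
    (hP : IsStarProjection P) : IsStarProjection (τ * P * τ†) := by
  have h1 : star τ * τ = 1 := Unitary.star_mul_self_of_mem hτ
  refine ⟨?_, hP.isSelfAdjoint.conjugate τ⟩
  change τ * P * star τ * (τ * P * star τ) = τ * P * star τ
  calc τ * P * star τ * (τ * P * star τ) = τ * P * (star τ * τ) * P * star τ := by
        simp only [mul_assoc]
    _ = τ * P * star τ := by
        rw [h1, mul_one, mul_assoc τ P P, hP.isIdempotentElem.eq]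

theorem conj_mem_unitary {τ U : F →L[ℂ] F} (hτ : τ ∈ unitary (F →L[ℂ] F))
    (hU : U ∈ unitary (F →L[ℂ] F)) : τ * U * τ† ∈ unitary (F →L[ℂ] F) :=
  mul_mem (mul_mem hτ hU) (Unitary.star_mem hτ)

theorem bclMul_conj {τ : F →L[ℂ] F} (hτ : τ ∈ unitary (F →L[ℂ] F)) (U P : F →L[ℂ] F) :
    bclMul (τ * U * τ†) (τ * P * τ†) =
      Hardy.mulPencil (τ * (U * (1 - P)) * τ†) (τ * (U * P) * τ†) := by
  have h1 : τ† * τ = 1 := Unitary.star_mul_self_of_mem hτ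
  have h2 : τ * U * τ† * (τ * P * τ†) = τ * (U * P) * τ† := by
    calc τ * U * τ† * (τ * P * τ†) = τ * U * (τ† * τ) * P * τ† := by simp only [mul_assoc]
      _ = τ * (U * P) * τ† := by rw [h1, mul_one, mul_assoc τ U P]
  have h3 : τ * U * τ† * (1 - τ * P * τ†) = τ * (U * (1 - P)) * τ† := by
    rw [mul_sub, h2, mul_one, mul_sub, mul_one, mul_sub, sub_mul]
  rw [bclMul, h2, h3]

/-! ### The Andô tuple -/

section Ando

variable {d : ℕ} {E : Type*} [NormedAddCommGroup E] [InnerProductSpace ℂ E] [CompleteSpace E]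

theorem AndoSpace.ext {S : Fin d → H →L[ℂ] H} {x y : AndoSpace S E}
    (h1 : ∀ i, x.fst i = y.fst i) (h2 : x.snd = y.snd) : x = y :=
  WithLp.ofLp_injective 2 (Prod.ext (PiLp.ext h1) h2)

theorem andoProj_fst (S : Fin d → H →L[ℂ] H) (j i : Fin d) (x : AndoSpace S E) :
    (andoProj S E j x).fst i = if i = j then x.fst i else 0 := by
  change (if i = j then PiLp.proj 2 (fun i => defectSpace (S i)) i ∘L WithLp.fstL 2 ℂ _ _
    else (0 : AndoSpace S E →L[ℂ] defectSpace (S i))) x = _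
  split_ifs <;> rfl

theorem andoProj_snd (S : Fin d → H →L[ℂ] H) (j : Fin d) (x : AndoSpace S E) :
    (andoProj S E j x).snd = 0 := rfl

theorem isStarProjection_andoProj (S : Fin d → H →L[ℂ] H) (j : Fin d) :
    IsStarProjection (andoProj S E j) := by
  refine ⟨?_, ?_⟩
  · ext x : 1
    refine AndoSpace.ext (fun i => ?_) rfl
    rw [mul_apply_eq_comp, andoProj_fst, andoProj_fst]
    split_ifs <;> rfl
  · refine ((ContinuousLinearMap.eq_adjoint_iff _ _).mpr fun x y => ?_).symm
    rw [WithLp.prod_inner_apply, WithLp.prod_inner_apply]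
    change inner ℂ (andoProj S E j x).fst y.fst + inner ℂ (andoProj S E j x).snd y.snd =
      inner ℂ x.fst (andoProj S E j y).fst + inner ℂ x.snd (andoProj S E j y).snd
    rw [andoProj_snd, andoProj_snd, inner_zero_left, inner_zero_right, PiLp.inner_apply,
      PiLp.inner_apply]
    congr 1
    refine Finset.sum_congr rfl fun i _ => ?_
    rw [andoProj_fst, andoProj_fst]
    split_ifs
    · rfl
    · rw [inner_zero_left, inner_zero_right]

theorem andoSource_fst_self (S : Fin d → H →L[ℂ] H) (j : Fin d) (h : H) :
    (andoSource S E j h).fst j = defectMap (S j) (omitProd S j h) := by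
  change (defectMap (S j) ∘L (if j = j then omitProd S j else _)) h = _
  rw [if_pos rfl]
  rfl

theorem andoSource_fst_of_ne (S : Fin d → H →L[ℂ] H) {i j : Fin d} (hij : i ≠ j) (h : H) :
    (andoSource S E j h).fst i =
      defectMap (S i) (subProd S (Finset.univ.filter fun k => i < k ∧ k ≠ j) h) := by
  change (defectMap (S i) ∘L (if i = j then omitProd S j else _)) h = _
  rw [if_neg hij]
  rfl

theorem andoTarget_fst_self (S : Fin d → H →L[ℂ] H) (j : Fin d) (h : H) :
    (andoTarget S E j h).fst j = defectMap (S j) h := by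
  change (defectMap (S j) ∘L (if j = j then 1 else _)) h = _
  rw [if_pos rfl]
  rfl

theorem andoTarget_fst_of_ne (S : Fin d → H →L[ℂ] H) {i j : Fin d} (hij : i ≠ j) (h : H) :
    (andoTarget S E j h).fst i =
      defectMap (S i) (subProd S (Finset.univ.filter fun k => i < k ∧ k ≠ j) (S j h)) := by
  change (defectMap (S i) ∘L (if i = j then 1 else _)) h = _
  rw [if_neg hij]
  rfl

theorem andoSource_snd (S : Fin d → H →L[ℂ] H) (j : Fin d) (h : H) :
    (andoSource S E j h).snd = 0 := rfl

theorem norm_andoSource {S : Fin d → H →L[ℂ] H} (hS : IsCommContractiveTuple S) (j : Fin d)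
    (h : H) : ‖andoSource S E j h‖ = ‖defectMap (fullProd S) h‖ := by
  refine (pow_left_inj₀ (norm_nonneg _) (norm_nonneg _) two_ne_zero).mp ?_
  have e1 : ‖defectMap (fullProd S) h‖ ^ 2 = ‖h‖ ^ 2 - ‖fullProd S h‖ ^ 2 :=
    norm_defect_sq _ hS.norm_fullProd_le h
  have e2 : ‖defectMap (S j) (omitProd S j h)‖ ^ 2 =
      ‖omitProd S j h‖ ^ 2 - ‖fullProd S h‖ ^ 2 := by
    rw [fullProd_eq_mul_omitProd hS.comm j]
    exact norm_defect_sq _ (hS.contr j) _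
  have e3 := sum_norm_defect_sq hS (Finset.univ.filter fun k => k ≠ j) h
  rw [WithLp.prod_norm_sq_eq_of_L2, andoSource_snd, norm_zero, PiLp.norm_sq_eq_of_L2,
    ← Finset.add_sum_erase _ _ (Finset.mem_univ j), andoSource_fst_self, e1, e2]
  have e4 : ∑ i ∈ Finset.univ.erase j, ‖(andoSource S E j h).fst i‖ ^ 2 =
      ‖h‖ ^ 2 - ‖omitProd S j h‖ ^ 2 := by
    rw [omitProd, ← e3, Finset.filter_ne']
    refine Finset.sum_congr rfl fun i hi => ?_
    rw [andoSource_fst_of_ne S (Finset.ne_of_mem_erase hi)]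
    have e5 : (Finset.univ.erase j).filter (fun k => i < k) =
        Finset.univ.filter fun k => i < k ∧ k ≠ j := by
      ext k
      simp [and_comm]
    rw [e5]
    rfl
  rw [e4]
  ring

theorem andoLambda_defectMap {S : Fin d → H →L[ℂ] H} (hS : IsCommContractiveTuple S) (j : Fin d)
    (h : H) : andoLambda S E j (defectMap (fullProd S) h) = andoSource S E j h := by
  refine LinearMap.extendOfNorm_eq (f := (andoSource S E j).toLinearMap)
    (e := (defectMap (fullProd S)).toLinearMap) (denseRange_toRangeClosure _) ⟨1, fun x => ?_⟩ h
  rw [one_mul]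
  exact (norm_andoSource hS j x).le

/-- The coefficient identity behind the pencil `U_j P_j^⊥ + z U_j P_j`. -/
theorem IsAndoTuple.adjoint_bclMul_source {S : Fin d → H →L[ℂ] H}
    (hS : IsCommContractiveTuple S) {U : Fin d → AndoSpace S E →L[ℂ] AndoSpace S E}
    (hU : IsAndoTuple S U) (j : Fin d) (h : H) :
    ((U j * (1 - andoProj S E j))†) (andoSource S E j h) +
      ((U j * andoProj S E j)†) (andoSource S E j (fullProd S h)) =
      andoSource S E j (S j h) := by
  have hP := isStarProjection_andoProj (E := E) S j
  rw [adjoint_mul_one_sub _ hP, adjoint_mul_of_isStarProjection _ hP,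
    mul_apply_eq_comp, mul_apply_eq_comp, hU.extends_, hU.extends_]
  refine AndoSpace.ext (fun i => ?_) ?_
  · change (andoTarget S E j h).fst i - (andoProj S E j (andoTarget S E j h)).fst i +
      (andoProj S E j (andoTarget S E j (fullProd S h))).fst i = _
    rw [andoProj_fst, andoProj_fst]
    by_cases hij : i = j
    · subst hij
      rw [if_pos rfl, if_pos rfl, sub_self, zero_add, andoTarget_fst_self, andoSource_fst_self]
      have : fullProd S = omitProd S i * S i := by
        rw [fullProd_eq_mul_omitProd hS.comm i]
        exact subProd_commute (hS.comm i) _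
      rw [this]
      rfl
    · rw [if_neg hij, if_neg hij, sub_zero, add_zero, andoTarget_fst_of_ne S hij,
        andoSource_fst_of_ne S hij]
  · change (0 : E) - 0 + 0 = 0
    simp

/-- The coefficient identity behind the pencil `P_j U_j* + z P_j^⊥ U_j*`: after applying
`U_j*` it compares components of the target vector at `S_(j) h` with those of source vectors. -/
theorem IsAndoTuple.adjoint_bclCoMul_source {S : Fin d → H →L[ℂ] H}
    (hS : IsCommContractiveTuple S) {U : Fin d → AndoSpace S E →L[ℂ] AndoSpace S E}
    (hU : IsAndoTuple S U) (j : Fin d) (h : H) :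
    ((andoProj S E j * (U j)†)†) (andoSource S E j h) +
      (((1 - andoProj S E j) * (U j)†)†) (andoSource S E j (fullProd S h)) =
      andoSource S E j (omitProd S j h) := by
  have hu : ∀ x, U j (((U j)†) x) = x := fun x =>
    congrArg (fun A : AndoSpace S E →L[ℂ] AndoSpace S E => A x)
      (Unitary.mul_star_self_of_mem (hU.isUnitary j))
  have hP := isStarProjection_andoProj (E := E) S j
  rw [adjoint_mul_adjoint, adjoint_mul_adjoint, hP.isSelfAdjoint.adjoint_eq,
    hP.one_sub.isSelfAdjoint.adjoint_eq,
    mul_apply_eq_comp, mul_apply_eq_comp, ← map_add,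
    ← hu (andoSource S E j (omitProd S j h)), hU.extends_]
  congr 1
  refine AndoSpace.ext (fun i => ?_) ?_
  · change (andoProj S E j (andoSource S E j h)).fst i +
      ((andoSource S E j (fullProd S h)).fst i -
        (andoProj S E j (andoSource S E j (fullProd S h))).fst i) = _
    rw [andoProj_fst, andoProj_fst]
    by_cases hij : i = j
    · subst hij
      rw [if_pos rfl, if_pos rfl, sub_self, add_zero, andoTarget_fst_self, andoSource_fst_self]
    · rw [if_neg hij, if_neg hij, sub_zero, zero_add, andoTarget_fst_of_ne S hij,
        andoSource_fst_of_ne S hij, fullProd_eq_mul_omitProd hS.comm j]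
      rfl
  · change (0 : E) + (0 - 0) = 0
    simp

end Ando

/-! ### The embedding and its intertwining relations -/

section Embedding

variable {d : ℕ} {E : Type*} [NormedAddCommGroup E] [InnerProductSpace ℂ E] [CompleteSpace E]
variable {T : Fin d → H →L[ℂ] H} (hT : IsCommContractiveTuple T)
variable {ι : asympSpace (fullProd T) →ₗᵢ[ℂ] R}

theorem liftEmbedding_fst_apply (j : Fin d) (h : H) (n : ℕ) :
    (liftEmbedding hT E ι j h).fst n =
      andoSource (adjTuple T) E j ((fullProd (adjTuple T) ^ n) h) :=
  andoLambda_defectMap hT.adj j _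

theorem liftEmbedding_snd (j : Fin d) (h : H) :
    (liftEmbedding hT E ι j h).snd = ι (asympMap (fullProd T) h) := rfl

/-- The Hardy component of `Π_j h` contributes `‖h‖² - lim ‖T*ⁿ h‖²` by telescoping, and the
other component contributes the limit. -/
theorem isometry_liftEmbedding (j : Fin d) : Isometry (liftEmbedding hT E ι j) := by
  refine AddMonoidHomClass.isometry_of_norm _ fun h => ?_
  refine (pow_left_inj₀ (norm_nonneg _) (norm_nonneg _) two_ne_zero).mp ?_
  rw [WithLp.prod_norm_sq_eq_of_L2, liftEmbedding_snd, LinearIsometry.norm_map, norm_hardy_sq]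
  have h0 : ∀ n, ‖(liftEmbedding hT E ι j h).fst n‖ ^ 2 =
      ‖(fullProd (adjTuple T) ^ n) h‖ ^ 2 - ‖(fullProd (adjTuple T) ^ (n + 1)) h‖ ^ 2 := by
    intro n
    rw [liftEmbedding_fst_apply, norm_andoSource hT.adj, pow_succ' _ n, mul_apply_eq_comp]
    exact norm_defect_sq _ hT.adj.norm_fullProd_le _
  have hlim := tendsto_norm_sq_adjoint_pow (fullProd T) hT.norm_fullProd_le h
  have hadj : (fullProd T)† = fullProd (adjTuple T) := (subProd_adjTuple hT.comm _).symm
  rw [hadj] at hlim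
  have hsum : HasSum (fun n => ‖(liftEmbedding hT E ι j h).fst n‖ ^ 2)
      (‖h‖ ^ 2 - ‖asympMap (fullProd T) h‖ ^ 2) := by
    rw [hasSum_iff_tendsto_nat_of_nonneg fun n => by positivity]
    refine (tendsto_const_nhds.sub hlim).congr fun n => ?_
    rw [Finset.sum_congr rfl fun n _ => h0 n, Finset.sum_range_sub']
    simp
  rw [hsum.tsum_eq]
  ring

/-- Intertwining relations for `Π_j` are checked coefficientwise on the Hardy space, and on the
range of `Q` in the other summand. -/
theorem liftEmbedding_comp (j : Fin d) {C : H →L[ℂ] H}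
    {A B : AndoSpace (adjTuple T) E →L[ℂ] AndoSpace (adjTuple T) E} {V : R →L[ℂ] R}
    (hC : Commute C (fullProd (adjTuple T)))
    (hAB : ∀ h, (A†) (andoSource (adjTuple T) E j h) +
      (B†) (andoSource (adjTuple T) E j (fullProd (adjTuple T) h)) =
        andoSource (adjTuple T) E j (C h))
    (hV : ∀ h, (V†) (ι (asympMap (fullProd T) h)) = ι (asympMap (fullProd T) (C h))) :
    liftEmbedding hT E ι j ∘L C =
      dirSum ((Hardy.mulPencil A B)†) (V†) ∘L liftEmbedding hT E ι j := by
  ext h : 1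
  refine WithLp.ofLp_injective 2 (Prod.ext ?_ (hV h).symm)
  refine lp.ext (funext fun n => ?_)
  change (liftEmbedding hT E ι j (C h)).fst n =
    ((Hardy.mulPencil A B)†) (liftEmbedding hT E ι j h).fst n
  rw [Hardy.adjoint_mulPencil_apply, liftEmbedding_fst_apply, liftEmbedding_fst_apply,
    liftEmbedding_fst_apply, pow_succ', mul_apply_eq_comp, hAB]
  congr 1
  exact congrArg (fun D : H →L[ℂ] H => D h) (hC.pow_right n).eq.symm

/-- The part of the lifting condition living on the unitary summand. -/
theorem IsCanonicalUnitaryTuple.adjoint_asympMap {W : Fin d → R →L[ℂ] R} {WD : R →L[ℂ] R}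
    (hT : IsCommContractiveTuple T) (hW : IsCanonicalUnitaryTuple T ι W WD) (i : Fin d) (h : H) :
    ((W i)†) (ι (asympMap (fullProd T) h)) = ι (asympMap (fullProd T) (((T i)†) h)) := by
  have h1 : (fullProd T)† = fullProd (adjTuple T) := (subProd_adjTuple hT.comm _).symm
  have hc : Commute ((T i)†) ((fullProd T)†) := by
    rw [h1]
    exact subProd_commute (hT.adj.comm i) _
  have hn : ‖(T i)†‖ ≤ 1 := hT.adj.contr i
  rw [hW.extends_, asympCompress_asympMap hT.norm_fullProd_le hn hc]

theorem adjoint_dirSum_apply_of_comp {A : F →L[ℂ] F} {V : R →L[ℂ] R} {C : H →L[ℂ] H}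
    {Pi : H →L[ℂ] WithLp 2 (F × R)} (h : Pi ∘L C = dirSum (A†) (V†) ∘L Pi) (x : H) :
    ((dirSum A V)†) (Pi x) = Pi (C x) := by
  rw [adjoint_dirSum]
  exact congrArg (fun B : H →L[ℂ] WithLp 2 (F × R) => B x) h.symm

end Embedding

end BCLLift

end

/-! ### The lifting theorem -/

set_option maxHeartbeats 600000 in
open BCLLift in
theorem mainTheorem5 {H E R : Type*}
    [NormedAddCommGroup H] [InnerProductSpace ℂ H] [CompleteSpace H]
    [NormedAddCommGroup E] [InnerProductSpace ℂ E] [CompleteSpace E]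
    [NormedAddCommGroup R] [InnerProductSpace ℂ R] [CompleteSpace R]
    (d : ℕ) (hd : 2 ≤ d)
    -- the commutative contractive tuple
    (T : Fin d → H →L[ℂ] H) (hT : IsCommContractiveTuple T)
    -- its canonical commutative unitary tuple, on `R`
    (ι : asympSpace (fullProd T) →ₗᵢ[ℂ] R) (W : Fin d → R →L[ℂ] R) (WD : R →L[ℂ] R)
    (hW : IsCanonicalUnitaryTuple T ι W WD)
    -- an Andô tuple for the adjoint tuple, on `𝒟_{T₁*} ⊕ ⋯ ⊕ 𝒟_{T_d*} ⊕ E`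
    (U : Fin d → AndoSpace (adjTuple T) E →L[ℂ] AndoSpace (adjTuple T) E)
    (hU : IsAndoTuple (adjTuple T) U) :
    -- part (1)
    (∀ j : Fin d,
      liftEmbedding hT E ι j ∘L (T j)† =
        dirSum ((bclMul (U j) (andoProj (adjTuple T) E j))†) ((W j)†) ∘L
          liftEmbedding hT E ι j ∧
      liftEmbedding hT E ι j ∘L (omitProd T j)† =
        dirSum ((bclCoMul (U j) (andoProj (adjTuple T) E j))†) ((omitProd W j)†) ∘L
          liftEmbedding hT E ι j ∧
      IsIsometricLift (liftEmbedding hT E ι j)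
        ![dirSum (bclMul (U j) (andoProj (adjTuple T) E j)) (W j),
          dirSum (bclCoMul (U j) (andoProj (adjTuple T) E j)) (omitProd W j),
          dirSum Hardy.shift WD]
        ![T j, omitProd T j, fullProd T]) ∧
    -- part (2), where the index `⟨0, _⟩` is the first one
    (∀ τ : Fin d → AndoSpace (adjTuple T) E →L[ℂ] AndoSpace (adjTuple T) E,
      (∀ j, τ j ∈ unitary (AndoSpace (adjTuple T) E →L[ℂ] AndoSpace (adjTuple T) E)) →
      (∀ j, τ j ∘L andoLambda (adjTuple T) E j =
        andoLambda (adjTuple T) E ⟨0, by omega⟩) →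
      τ ⟨0, by omega⟩ = 1 →
      (∀ j : Fin d,
        liftEmbedding hT E ι ⟨0, by omega⟩ ∘L (T j)† =
          dirSum
            ((Hardy.mulPencil
              (τ j * (U j * (1 - andoProj (adjTuple T) E j)) * (τ j)†)
              (τ j * (U j * andoProj (adjTuple T) E j) * (τ j)†))†) ((W j)†) ∘L
            liftEmbedding hT E ι ⟨0, by omega⟩ ∧
        liftEmbedding hT E ι ⟨0, by omega⟩ ∘L (omitProd T j)† =
          dirSum
            ((Hardy.mulPencil
              (τ j * (andoProj (adjTuple T) E j * (U j)†) * (τ j)†)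
              (τ j * ((1 - andoProj (adjTuple T) E j) * (U j)†) * (τ j)†))†)
              ((omitProd W j)†) ∘L
            liftEmbedding hT E ι ⟨0, by omega⟩) ∧
      (∀ j : Fin d,
        IsStarProjection (τ j * andoProj (adjTuple T) E j * (τ j)†) ∧
        τ j * U j * (τ j)† ∈ unitary (AndoSpace (adjTuple T) E →L[ℂ] AndoSpace (adjTuple T) E)) ∧
      IsIsometricLift (liftEmbedding hT E ι ⟨0, by omega⟩)
        (fun j : Fin d =>
          dirSum
            (bclMul (τ j * U j * (τ j)†) (τ j * andoProj (adjTuple T) E j * (τ j)†)) (W j))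
        T) := by
  -- With `C = T_j*`, `T_(j)*` and `T*`, all relations to be shown say that `Π_j` or `Π_1`
  -- intertwines `C` with the adjoint of a pencil, so that `liftEmbedding_comp` applies.
  obtain rfl : WD = fullProd W := hW.prod_eq
  have hfull : (fullProd T)† = fullProd (adjTuple T) := (subProd_adjTuple hT.comm _).symm
  have homit : ∀ j, (omitProd T j)† = omitProd (adjTuple T) j := fun j =>
    (subProd_adjTuple hT.comm _).symm
  have hC1 : ∀ j, Commute ((T j)†) (fullProd (adjTuple T)) := fun j =>
    subProd_commute (hT.adj.comm j) _
  have hC2 : ∀ j, Commute ((omitProd T j)†) (fullProd (adjTuple T)) := fun j => by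
    rw [homit]
    exact (subProd_commute (fun i => (subProd_commute (hT.adj.comm i) _).symm) _)
  have hV1 := hW.adjoint_asympMap hT
  have hV2 : ∀ s h, ((subProd W s)†) (ι (asympMap (fullProd T) h)) =
      ι (asympMap (fullProd T) (((subProd T s)†) h)) := fun s h =>
    adjoint_subProd_intertwine (q := fun h => ι (asympMap (fullProd T) h)) hV1 s h
  have hA1 := hU.adjoint_bclMul_source hT.adj
  have hA2 : ∀ j h, _ = andoSource (adjTuple T) E j (((omitProd T j)†) h) := fun j h =>
    (hU.adjoint_bclCoMul_source hT.adj j h).trans (by rw [homit])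
  have hun : ∀ {V : R →L[ℂ] R}, V ∈ unitary (R →L[ℂ] R) → V† * V = 1 := fun hV =>
    Unitary.star_mul_self_of_mem hV
  have hP := fun j => isStarProjection_andoProj (E := E) (adjTuple T) j
  refine ⟨fun j => ?_, fun τ hτ hτΛ _ => ?_⟩
  · have e1 := liftEmbedding_comp hT j (hC1 j) (hA1 j) (hV1 j)
    have e2 := liftEmbedding_comp hT j (hC2 j) (hA2 j) (hV2 _)
    -- `M_z` is multiplication by the pencil with coefficients `0` and `1`
    have e3 := liftEmbedding_comp hT (E := E) j (C := (fullProd T)†) (A := 0) (B := 1)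
      (by rw [hfull]) (by
        intro h
        have h0 : ((0 : AndoSpace (adjTuple T) E →L[ℂ] AndoSpace (adjTuple T) E))† = 0 :=
          map_zero _
        have h1 : ((1 : AndoSpace (adjTuple T) E →L[ℂ] AndoSpace (adjTuple T) E))† = 1 :=
          star_one _
        rw [h0, h1, hfull]
        exact zero_add _) (hV2 Finset.univ)
    have hshift : Hardy.mulPencil (0 : AndoSpace (adjTuple T) E →L[ℂ] AndoSpace (adjTuple T) E) 1
        = Hardy.shift := by
      rw [Hardy.mulPencil, Hardy.map_zero, Hardy.map_one, zero_add, mul_one]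
    rw [hshift] at e3
    have i1 := isometry_dirSum (bclMul_adjoint_mul_self (hU.isUnitary j) (hP j))
      (hun (hW.isUnitary j))
    have i2 := isometry_dirSum (bclCoMul_adjoint_mul_self (hU.isUnitary j) (hP j))
      (hun (subProd_mem_unitary hW.isUnitary (Finset.univ.filter fun k => k ≠ j)))
    have i3 := isometry_dirSum_shift (F := AndoSpace (adjTuple T) E)
      (hun (subProd_mem_unitary hW.isUnitary Finset.univ))
    have l1 := adjoint_dirSum_apply_of_comp e1
    have l2 := adjoint_dirSum_apply_of_comp e2
    have l3 := adjoint_dirSum_apply_of_comp e3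
    refine ⟨e1, e2, ⟨isometry_liftEmbedding hT j, ?_⟩, ?_⟩
    · rw [Fin.forall_fin_succ, Fin.forall_fin_two]
      exact ⟨l1, l2, l3⟩
    · rw [Fin.forall_fin_succ, Fin.forall_fin_two]
      exact ⟨i1, i2, i3⟩
  · have hsrc : ∀ j h, τ j (andoSource (adjTuple T) E j h) =
        andoSource (adjTuple T) E ⟨0, by omega⟩ h := by
      intro j h
      rw [← andoLambda_defectMap hT.adj, ← andoLambda_defectMap hT.adj, ← hτΛ j]
      rfl
    -- conjugation by `τ j` carries the coefficient identities for `Λ_j` to those for `Λ_1`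
    have hconj : ∀ (j : Fin d) {A B : AndoSpace (adjTuple T) E →L[ℂ] AndoSpace (adjTuple T) E}
        {C : H →L[ℂ] H},
        (∀ h, (A†) (andoSource (adjTuple T) E j h) +
          (B†) (andoSource (adjTuple T) E j (fullProd (adjTuple T) h)) =
            andoSource (adjTuple T) E j (C h)) →
        ∀ h, ((τ j * A * (τ j)†)†) (andoSource (adjTuple T) E ⟨0, by omega⟩ h) +
          ((τ j * B * (τ j)†)†)
            (andoSource (adjTuple T) E ⟨0, by omega⟩ (fullProd (adjTuple T) h)) =
            andoSource (adjTuple T) E ⟨0, by omega⟩ (C h) := by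
      intro j A B C hAB h
      rw [adjoint_conj_apply (hτ j) A (hsrc j h), adjoint_conj_apply (hτ j) B (hsrc j _),
        ← map_add, hAB, hsrc]
    have e1 := fun j => liftEmbedding_comp hT (ι := ι) ⟨0, by omega⟩ (hC1 j)
      (hconj j (hA1 j)) (hV1 j)
    have e2 := fun j => liftEmbedding_comp hT (ι := ι) ⟨0, by omega⟩ (hC2 j)
      (hconj j (hA2 j)) (hV2 _)
    refine ⟨fun j => ⟨e1 j, e2 j⟩,
      fun j => ⟨isStarProjection_conj (hτ j) (hP j), conj_mem_unitary (hτ j) (hU.isUnitary j)⟩,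
      ⟨isometry_liftEmbedding hT _, fun j h => ?_⟩, fun j => ?_⟩
    · beta_reduce
      rw [bclMul_conj (hτ j)]
      exact adjoint_dirSum_apply_of_comp (e1 j) h
    · exact isometry_dirSum (bclMul_adjoint_mul_self (conj_mem_unitary (hτ j) (hU.isUnitary j))
        (isStarProjection_conj (hτ j) (hP j))) (hun (hW.isUnitary j))
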